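/- For real $\alpha>-1$ and real $\mu,z$ let $$\phi(\alpha,\mu;z)=\sum_{n=0}^{\infty}\frac{z^n}{n!\,\Gamma(\alpha n+\mu)}$$ be the Wright function, where $1/\Gamma$ is taken to be $0$ at the poles of $\Gamma$. Let $g$ be a real- or complex-valued function that is absolutely integrable on every finite interval $(0,T)$, $T>0$, and continuous at the point $t=1$. Suppose that there are real numbers $\sigma>0$ and $\delta$ such that $g(t)=O\bigl(\exp\{\sigma t^{\delta}\}\bigr)$ as $t\to\infty$. Then for every $\beta\in(0,1)$ with $\delta<\frac{1}{1-\beta}$ the integral $\int_0^\infty g(t)\,\phi(-\beta,1-\beta;-t)\,dt$ converges absolutely (the condition on $\beta$ holds for all $\beta<1$ sufficiently close to $1$), and $$\lim_{\beta\to 1^-}\int_0^\infty g(t)\,\phi(-\beta,1-\beta;-t)\,dt=g(1).$$ -/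

import Mathlib

open Set Filter Topology MeasureTheory Asymptotics

/-- The Wright function `φ(α, μ; z) = ∑_{n ≥ 0} z ^ n / (n! Γ(α n + μ))` of real arguments.
At the poles of `Γ` the coefficient `1 / Γ` is `0`, as usual: `Real.Gamma` takes the value `0`
there and division by `0` gives `0`. The series converges absolutely for `-1 < α`. -/
noncomputable def wrightPhi (α μ z : ℝ) : ℝ :=
  ∑' n : ℕ, z ^ n / ((n.factorial : ℝ) * Real.Gamma (α * (n : ℝ) + μ))

/-!
The function `t ↦ φ(-β, 1 - β; -t)` behaves like a probability density that concentrates at `t = 1`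
as `β → 1⁻`. It is nonnegative because, up to a power of `k`, it is the limit as `k → ∞` of the
coefficient of `x ^ k` in `(1 - x) ^ (-μ) * exp (-l * (1 - x) ^ β)` with `μ = 1 - β` and
`l = t * k ^ β`, and these coefficients are nonnegative. Comparing a coefficient with the value of
its power series at a suitable point (Chernoff's method) shows that the density decays faster than
any `exp (-A * t ^ K)` to the right of `1`. To the left of `1` the reflection formula for `Γ` bounds
every term of the series by a multiple of `1 - β`. The mass of `[0, T]` is `1 - φ(-β, 1; -T)`, which
tends to `1` for `T > 1` by the Chernoff bound.
-/

/-! ### Binomial coefficients of negative real exponents -/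

theorem succ_mul_multichoose_succ (s : ℝ) (k : ℕ) :
    (k + 1) * Ring.multichoose s (k + 1) = (s + k) * Ring.multichoose s k := by
  have hfac (m : ℕ) : (m.factorial : ℝ) * Ring.multichoose s m = (ascPochhammer ℝ m).eval s := by
    rw [← nsmul_eq_mul, Ring.factorial_nsmul_multichoose_eq_ascPochhammer,
      Polynomial.ascPochhammer_smeval_eq_eval]
  have hk : (k.factorial : ℝ) ≠ 0 := by positivity
  have hsucc := hfac (k + 1)
  rw [ascPochhammer_succ_eval, ← hfac k, Nat.factorial_succ] at hsucc
  push_cast at hsucc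
  refine mul_left_cancel₀ hk ?_
  linear_combination hsucc

theorem multichoose_eq_prod_range (s : ℝ) (k : ℕ) :
    Ring.multichoose s k = ∏ j ∈ Finset.range k, (s + j) / (j + 1) := by
  induction k with
  | zero => simp
  | succ k ih =>
    rw [Finset.prod_range_succ, ← ih, mul_div_assoc', eq_div_iff (by positivity)]
    linear_combination succ_mul_multichoose_succ s k

theorem succ_mul_multichoose_succ' (s : ℝ) (k : ℕ) :
    (k + 1) * Ring.multichoose s (k + 1) = s * Ring.multichoose (s + 1) k := by
  rw [multichoose_eq_prod_range, multichoose_eq_prod_range, Finset.prod_div_distrib,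
    Finset.prod_div_distrib, Finset.prod_range_succ' (fun j : ℕ => s + j),
    Finset.prod_range_succ (fun j : ℕ => (j : ℝ) + 1)]
  have hk : (k : ℝ) + 1 ≠ 0 := by positivity
  push_cast
  simp only [add_zero, add_assoc, add_comm (1 : ℝ)]
  field_simp

theorem multichoose_add (s t : ℝ) (k : ℕ) :
    Ring.multichoose (s + t) k =
      ∑ ij ∈ Finset.HasAntidiagonal.antidiagonal k,
        Ring.multichoose s ij.1 * Ring.multichoose t ij.2 := by
  have hchoose := Ring.add_choose_eq k (Commute.all (-s) (-t))
  rw [← neg_add, Ring.choose_neg'] at hchoose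
  refine smul_left_cancel (Int.negOnePow k) (hchoose.trans ?_)
  rw [Finset.smul_sum]
  refine Finset.sum_congr rfl fun ij hij => ?_
  rw [Ring.choose_neg', Ring.choose_neg', smul_mul_smul_comm, ← Int.negOnePow_add,
    ← Nat.cast_add, Finset.HasAntidiagonal.mem_antidiagonal.1 hij]

theorem multichoose_nonneg {s : ℝ} (hs : 0 ≤ s) (k : ℕ) : 0 ≤ Ring.multichoose s k := by
  rw [multichoose_eq_prod_range]
  exact Finset.prod_nonneg fun _ _ => by positivity

theorem abs_multichoose_le {s t : ℝ} (hst : |s| ≤ t) (k : ℕ) :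
    |Ring.multichoose s k| ≤ Ring.multichoose t k := by
  rw [multichoose_eq_prod_range, multichoose_eq_prod_range, Finset.abs_prod]
  refine Finset.prod_le_prod (fun _ _ => abs_nonneg _) fun j _ => ?_
  rw [abs_div, abs_of_pos (by positivity : (0 : ℝ) < j + 1)]
  gcongr
  exact (abs_add_le _ _).trans (by simpa using hst)

theorem hasSum_multichoose_mul_pow (s : ℝ) {x : ℝ} (hx : |x| < 1) :
    HasSum (fun k => Ring.multichoose s k * x ^ k) ((1 - x) ^ (-s)) := by
  have hseries := (Real.one_div_one_sub_rpow_hasFPowerSeriesOnBall_zero s).hasSum (y := x)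
    (by simpa [enorm_eq_nnnorm, ← NNReal.coe_lt_coe] using hx)
  rw [zero_add, one_div, ← Real.rpow_neg (by linarith [le_abs_self x])] at hseries
  simpa [Ring.multichoose_eq, mul_comm] using hseries

theorem tendsto_rpow_mul_multichoose (s : ℝ) :
    Tendsto (fun k : ℕ => (k : ℝ) ^ (1 - s) * Ring.multichoose s k) atTop
      (𝓝 (Real.Gamma s)⁻¹) := by
  by_cases hpole : ∃ m : ℕ, s = -m
  · obtain ⟨m, rfl⟩ := hpole
    rw [Real.Gamma_neg_nat_eq_zero, inv_zero]
    refine tendsto_const_nhds.congr' ?_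
    filter_upwards [eventually_gt_atTop m] with k hk
    rw [multichoose_eq_prod_range, Finset.prod_eq_zero (Finset.mem_range.2 hk) (by simp), mul_zero]
  push Not at hpole
  have hlim : Tendsto (fun k : ℕ => (Real.GammaSeq s k)⁻¹ * (1 - s / (s + k))) atTop
      (𝓝 ((Real.Gamma s)⁻¹ * (1 - 0))) :=
    ((Real.GammaSeq_tendsto_Gamma s).inv₀ (Real.Gamma_ne_zero hpole)).mul
      (tendsto_const_nhds.sub (tendsto_const_nhds.div_atTop
        (tendsto_atTop_add_const_left _ _ tendsto_natCast_atTop_atTop)))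
  rw [sub_zero, mul_one] at hlim
  refine hlim.congr' ?_
  filter_upwards [eventually_gt_atTop 0] with k hk
  have hk0 : (0 : ℝ) < k := by exact_mod_cast hk
  have hsk : s + k ≠ 0 := fun h => hpole k (eq_neg_of_add_eq_zero_left h)
  have hfac : ∏ j ∈ Finset.range k, ((j : ℝ) + 1) = k.factorial := by
    exact_mod_cast Finset.prod_range_add_one_eq_factorial k
  rw [Real.GammaSeq, multichoose_eq_prod_range, Finset.prod_div_distrib, hfac,
    Finset.prod_range_succ, Real.rpow_sub hk0, Real.rpow_one, inv_div]
  have : (k : ℝ) ^ s ≠ 0 := by positivity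
  field_simp
  ring

theorem prod_range_le_prod_range {a w : ℕ → ℝ} {m : ℕ} (ha : ∀ j, 0 ≤ a j)
    (haw : ∀ j < m, a j ≤ w j) (hw : ∀ j < m, 1 ≤ w j) (ha1 : ∀ j, m ≤ j → a j ≤ 1) (k : ℕ) :
    ∏ j ∈ Finset.range k, a j ≤ ∏ j ∈ Finset.range m, w j := by
  have hw0 : ∀ j ∈ Finset.range m, 0 ≤ w j := fun j hj =>
    zero_le_one.trans (hw j (Finset.mem_range.1 hj))
  rcases le_total k m with hkm | hmk
  · calc ∏ j ∈ Finset.range k, a j ≤ ∏ j ∈ Finset.range k, w j :=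
          Finset.prod_le_prod (fun j _ => ha j) fun j hj =>
            haw j ((Finset.mem_range.1 hj).trans_le hkm)
      _ ≤ ∏ j ∈ Finset.range m, w j :=
          Finset.prod_le_prod_of_subset_of_one_le (Finset.range_mono hkm)
            (fun j hj => hw0 j (Finset.range_mono hkm hj)) fun j hj _ =>
            hw j (Finset.mem_range.1 hj)
  · rw [← Finset.prod_range_mul_prod_Ico a hmk, ← mul_one (∏ j ∈ Finset.range m, w j)]
    exact mul_le_mul
      (Finset.prod_le_prod (fun j _ => ha j) fun j hj => haw j (Finset.mem_range.1 hj))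
      (Finset.prod_le_one (fun j _ => ha j) fun j hj => ha1 j (Finset.mem_Ico.1 hj).1)
      (Finset.prod_nonneg fun j _ => ha j) (Finset.prod_nonneg hw0)

theorem prod_range_exp_div_eq (y : ℝ) (k : ℕ) :
    ∏ j ∈ Finset.range k, Real.exp (y / (j + 1)) = Real.exp (y * harmonic k) := by
  rw [← Real.exp_sum, harmonic]
  push_cast
  simp only [Finset.mul_sum, div_eq_mul_inv]

theorem abs_one_sub_mul_exp_le_one {u : ℝ} (hu : u ≤ 1) : |1 - u| * Real.exp u ≤ 1 := by
  rw [abs_of_nonneg (sub_nonneg.2 hu), ← le_div_iff₀ (Real.exp_pos u), one_div, ← Real.exp_neg]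
  exact Real.one_sub_le_exp_neg u

theorem abs_one_sub_mul_exp_le {u v : ℝ} (huv : |u| ≤ v) (hv : 1 ≤ v) :
    |1 - u| * Real.exp u ≤ 2 * v * Real.exp v := by
  have hsub : |1 - u| ≤ 2 * v := by
    have := abs_sub 1 u
    rw [abs_one] at this
    linarith
  gcongr
  exact (le_abs_self u).trans huv

theorem prod_abs_one_sub_div_mul_exp_le {y Y : ℝ} (hY : 1 ≤ Y) (hyY : |y| ≤ Y) (k : ℕ) :
    ∏ j ∈ Finset.range k, |1 - y / (j + 1)| * Real.exp (y / (j + 1)) ≤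
      Real.exp (3 * Y) * Y ^ Y := by
  have hY0 : 0 < Y := zero_lt_one.trans_le hY
  set m := ⌊Y⌋₊
  have hm0 : 0 < m := Nat.floor_pos.2 hY
  have hratio : ∀ j < m, 1 ≤ Y / ((j : ℝ) + 1) := fun j hj => by
    rw [one_le_div (by positivity)]
    exact (by exact_mod_cast hj : (j : ℝ) + 1 ≤ m).trans (Nat.floor_le hY0.le)
  calc ∏ j ∈ Finset.range k, |1 - y / ((j : ℝ) + 1)| * Real.exp (y / (j + 1))
      ≤ ∏ j ∈ Finset.range m, 2 * (Y / ((j : ℝ) + 1)) * Real.exp (Y / (j + 1)) := by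
        refine prod_range_le_prod_range (fun j => by positivity)
          (fun j hj => abs_one_sub_mul_exp_le ?_ (hratio j hj))
          (fun j hj => ?_) (fun j hj => abs_one_sub_mul_exp_le_one ?_) k
        · rw [abs_div, abs_of_pos (by positivity : (0 : ℝ) < j + 1)]
          gcongr
        · exact one_le_mul_of_one_le_of_one_le (by linarith [hratio j hj])
            (Real.one_le_exp (by positivity))
        · rw [div_le_one (by positivity)]
          have : (m : ℝ) ≤ j := by exact_mod_cast hj
          linarith [le_abs_self y, Nat.lt_floor_add_one Y]
    _ = (2 * Y) ^ m / m.factorial * Real.exp (Y * harmonic m) := by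
        rw [Finset.prod_mul_distrib, prod_range_exp_div_eq]
        simp only [← mul_div_assoc]
        rw [Finset.prod_div_distrib, Finset.prod_const, Finset.card_range,
          ← Finset.prod_range_add_one_eq_factorial]
        push_cast
        rfl
    _ ≤ Real.exp (2 * Y) * Real.exp (Y * (1 + Real.log Y)) := by
        gcongr
        · exact Real.pow_div_factorial_le_exp _ (by positivity) m
        · refine (harmonic_le_one_add_log m).trans ?_
          gcongr
          exact Nat.floor_le hY0.le
    _ = Real.exp (3 * Y) * Y ^ Y := by
        rw [Real.rpow_def_of_pos hY0, ← Real.exp_add, ← Real.exp_add]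
        ring_nf

theorem rpow_mul_exp_neg_mul_harmonic_le (y : ℝ) {k : ℕ} (hk : 0 < k) :
    (k : ℝ) ^ y * Real.exp (-(y * harmonic k)) ≤ Real.exp |y| := by
  have hk0 : (0 : ℝ) < k := by exact_mod_cast hk
  have hlog : |Real.log k - harmonic k| ≤ 1 := by
    have hlower : Real.log k ≤ harmonic k :=
      (Real.log_le_log hk0 (by simp)).trans (log_add_one_le_harmonic k)
    rw [abs_le]
    constructor <;> linarith [harmonic_le_one_add_log k]
  rw [Real.rpow_def_of_pos hk0, ← Real.exp_add, Real.exp_le_exp]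
  calc Real.log k * y + -(y * harmonic k) = y * (Real.log k - harmonic k) := by ring
    _ ≤ |y| * |Real.log k - harmonic k| := by rw [← abs_mul]; exact le_abs_self _
    _ ≤ |y| := mul_le_of_le_one_right (abs_nonneg y) hlog

theorem rpow_mul_abs_multichoose_one_sub_le {y Y : ℝ} (hY : 1 ≤ Y) (hyY : |y| ≤ Y) {k : ℕ}
    (hk : 0 < k) :
    (k : ℝ) ^ y * |Ring.multichoose (1 - y) k| ≤ Real.exp (4 * Y) * Y ^ Y := by
  have hprod : |Ring.multichoose (1 - y) k| = Real.exp (-(y * harmonic k)) *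
      ∏ j ∈ Finset.range k, |1 - y / (j + 1)| * Real.exp (y / (j + 1)) := by
    rw [multichoose_eq_prod_range, Finset.abs_prod, Finset.prod_mul_distrib,
      prod_range_exp_div_eq, mul_left_comm, ← Real.exp_add, neg_add_cancel, Real.exp_zero, mul_one]
    refine Finset.prod_congr rfl fun j _ => ?_
    congr 1
    field_simp
    ring
  rw [hprod, ← mul_assoc]
  calc _ ≤ Real.exp |y| * (Real.exp (3 * Y) * Y ^ Y) :=
        mul_le_mul (rpow_mul_exp_neg_mul_harmonic_le y hk)
          (prod_abs_one_sub_div_mul_exp_le hY hyY k)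
          (Finset.prod_nonneg fun _ _ => by positivity) (Real.exp_nonneg _)
    _ ≤ Real.exp Y * (Real.exp (3 * Y) * Y ^ Y) := by gcongr
    _ = Real.exp (4 * Y) * Y ^ Y := by rw [← mul_assoc, ← Real.exp_add]; ring_nf

theorem exp_mul_log_sub_le_factorial (n : ℕ) : Real.exp (n * Real.log n - n) ≤ n.factorial := by
  rcases n.eq_zero_or_pos with rfl | hn
  · simp
  have hn0 : (0 : ℝ) < n := by exact_mod_cast hn
  rw [Real.exp_sub, Real.exp_nat_mul, Real.exp_log hn0,
    div_le_comm₀ (Real.exp_pos _) (by positivity)]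
  exact Real.pow_div_factorial_le_exp (n : ℝ) hn0.le n

theorem pow_div_factorial_mul_exp_mul_rpow_le {y γ : ℝ} {n : ℕ} (hy : 0 < y) (hyγ : y ≤ γ * n)
    (hγ : γ ≤ 1) (hn : 0 < n) (R C : ℝ) :
    |R| ^ n / n.factorial * (Real.exp (C * y) * y ^ y) ≤
      Real.exp (n * (Real.log (|R| + 1) + |C| + 1 - (1 - γ) * Real.log n)) := by
  have hn0 : (0 : ℝ) < n := by exact_mod_cast hn
  have hyn : y ≤ n := hyγ.trans (mul_le_of_le_one_left hn0.le hγ)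
  have : 0 ≤ Real.log n := Real.log_natCast_nonneg n
  have hR : |R| ^ n ≤ Real.exp (n * Real.log (|R| + 1)) := by
    rw [Real.exp_nat_mul, Real.exp_log (by positivity)]
    gcongr
    linarith
  have hyy : y ^ y ≤ Real.exp (γ * n * Real.log n) := by
    rw [Real.rpow_def_of_pos hy, Real.exp_le_exp, mul_comm]
    calc y * Real.log y ≤ y * Real.log n := by gcongr
      _ ≤ γ * n * Real.log n := by gcongr
  calc |R| ^ n / n.factorial * (Real.exp (C * y) * y ^ y)
      ≤ Real.exp (n * Real.log (|R| + 1)) / Real.exp (n * Real.log n - n) *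
        (Real.exp (|C| * n) * Real.exp (γ * n * Real.log n)) := by
        gcongr
        · exact exp_mul_log_sub_le_factorial n
        · exact le_abs_self C
    _ = _ := by
        rw [← Real.exp_sub, ← Real.exp_add, ← Real.exp_add]
        ring_nf

theorem summable_pow_div_factorial_mul_exp_mul_rpow {β b : ℝ} (hβ0 : 0 ≤ β) (hβ1 : β < 1)
    (hb : 0 < b) (R C : ℝ) :
    Summable fun n : ℕ => R ^ n / n.factorial *
      (Real.exp (C * (β * n + b)) * (β * n + b) ^ (β * n + b)) := by
  obtain ⟨γ, hβγ, hγ1⟩ := exists_between hβ1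
  have hlin : ∀ᶠ n : ℕ in atTop, b ≤ (γ - β) * n :=
    (tendsto_natCast_atTop_atTop.const_mul_atTop (sub_pos.2 hβγ)).eventually_ge_atTop b
  have hlog : ∀ᶠ n : ℕ in atTop, Real.log (|R| + 1) + |C| + 2 ≤ (1 - γ) * Real.log n :=
    ((Real.tendsto_log_atTop.comp tendsto_natCast_atTop_atTop).const_mul_atTop
      (sub_pos.2 hγ1)).eventually_ge_atTop _
  refine summable_of_isBigO_nat Real.summable_exp_neg_nat (IsBigO.of_bound 1 ?_)
  filter_upwards [hlin, hlog, eventually_gt_atTop 0] with n hlin hlog hn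
  have hy : 0 < β * n + b := by positivity
  rw [one_mul, Real.norm_eq_abs, Real.norm_eq_abs, Real.abs_exp, abs_mul, abs_div, abs_pow,
    Nat.abs_cast, abs_of_pos (mul_pos (Real.exp_pos _) (Real.rpow_pos_of_pos hy _))]
  refine (pow_div_factorial_mul_exp_mul_rpow_le hy (by linarith) hγ1.le hn R C).trans ?_
  rw [Real.exp_le_exp, ← mul_neg_one]
  gcongr
  linarith

/-! ### Exponentials of translation operators -/

/-- The value at `μ` of `exp (z T) f = ∑ n, z ^ n / n! • T ^ n f`, where `T` is the translation
`(T f) s = f (s - β)`. For `f = 1 / Γ` it is the Wright function, and for a binomial coefficient `f`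
its discrete analogue `discreteWright`. -/
noncomputable def expShift (f : ℝ → ℝ) (β μ z : ℝ) : ℝ :=
  ∑' n : ℕ, z ^ n / n.factorial * f (μ - β * n)

/-- Convergence of all the series that define `expShift f β`. -/
def ExpShiftSummable (f : ℝ → ℝ) (β : ℝ) : Prop :=
  ∀ μ z : ℝ, Summable fun n : ℕ => z ^ n / n.factorial * f (μ - β * n)

theorem expShift_zero (f : ℝ → ℝ) (β μ : ℝ) : expShift f β μ 0 = f μ := by
  rw [expShift, tsum_eq_single 0 fun n hn => by simp [hn]]
  simp

theorem expShift_const (c β μ z : ℝ) : expShift (fun _ => c) β μ z = Real.exp z * c := by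
  rw [expShift, tsum_mul_right, Real.exp_eq_exp_ℝ, NormedSpace.exp_eq_tsum_div]

theorem expShift_rescale (f : ℝ → ℝ) (β μ z : ℝ) {c : ℝ} (hc : 0 < c) :
    expShift (fun s => c ^ (1 - s) * f s) β μ z = c ^ (1 - μ) * expShift f β μ (z * c ^ β) := by
  rw [expShift, expShift, ← tsum_mul_left]
  refine tsum_congr fun n => ?_
  rw [show 1 - (μ - β * n) = 1 - μ + β * n by ring, Real.rpow_add hc, Real.rpow_mul_natCast hc.le,
    mul_pow]
  ring

theorem expShiftSummable_of_abs_le_exp {f : ℝ → ℝ} {C A : ℝ}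
    (hf : ∀ s, |f s| ≤ C * Real.exp (A * |s|)) (β : ℝ) : ExpShiftSummable f β := by
  intro μ z
  have hC : 0 ≤ C :=
    nonneg_of_mul_nonneg_left ((abs_nonneg _).trans (hf 0)) (Real.exp_pos _)
  refine ((Real.summable_pow_div_factorial (|z| * Real.exp (|A| * |β|))).mul_left
    (C * Real.exp (|A| * |μ|))).of_norm_bounded fun n => ?_
  have hshift : A * |μ - β * n| ≤ |A| * |μ| + n * (|A| * |β|) := by
    calc A * |μ - β * n| ≤ |A| * (|μ| + |β * n|) := by
          gcongr
          · exact le_abs_self A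
          · exact abs_sub _ _
      _ = _ := by rw [abs_mul, Nat.abs_cast]; ring
  calc ‖z ^ n / n.factorial * f (μ - β * n)‖
      = |z| ^ n / n.factorial * |f (μ - β * n)| := by
        rw [Real.norm_eq_abs, abs_mul, abs_div, abs_pow, Nat.abs_cast]
    _ ≤ |z| ^ n / n.factorial * (C * Real.exp (|A| * |μ| + n * (|A| * |β|))) := by
        gcongr
        exact (hf _).trans (by gcongr)
    _ = _ := by
        rw [Real.exp_add, Real.exp_nat_mul, mul_pow]
        ring

namespace ExpShiftSummable

variable {f : ℝ → ℝ} {β : ℝ}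

theorem hasSum (hf : ExpShiftSummable f β) (μ z : ℝ) :
    HasSum (fun n : ℕ => z ^ n / n.factorial * f (μ - β * n)) (expShift f β μ z) :=
  (hf μ z).hasSum

theorem hasSum_deriv (hf : ExpShiftSummable f β) (μ z : ℝ) :
    HasSum (fun n : ℕ => n * z ^ (n - 1) / n.factorial * f (μ - β * n))
      (expShift f β (μ - β) z) := by
  rw [← hasSum_nat_add_iff' 1]
  simp only [Finset.sum_range_one, Nat.cast_zero, zero_mul, zero_div, sub_zero]
  refine (hf.hasSum (μ - β) z).congr_fun fun n => ?_
  rw [Nat.factorial_succ, Nat.add_sub_cancel]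
  push_cast
  rw [mul_div_mul_left _ _ (by positivity), mul_add_one, sub_sub, add_comm β]

theorem recurrence {a : ℝ → ℝ} (hf : ExpShiftSummable f β) (ha : ∀ s, a s = s * f (s + 1))
    (μ z : ℝ) :
    expShift a β μ z = μ * expShift f β (μ + 1) z - β * z * expShift f β (μ + 1 - β) z := by
  have hterms := ((hf.hasSum (μ + 1) z).mul_left μ).sub
    ((hf.hasSum_deriv (μ + 1) z).mul_left (β * z))
  rw [← hterms.tsum_eq, expShift]
  refine tsum_congr fun n => ?_
  rw [ha, sub_add_eq_add_sub]
  rcases n with _ | n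
  · simp
  · rw [Nat.add_sub_cancel, pow_succ]
    push_cast
    ring

theorem hasDerivAt (hf : ExpShiftSummable f β) (μ z : ℝ) :
    HasDerivAt (expShift f β μ) (expShift f β (μ - β) z) z := by
  rw [← (hf.hasSum_deriv μ z).tsum_eq]
  refine hasDerivAt_tsum_of_isPreconnected
    (g := fun (n : ℕ) y => y ^ n / n.factorial * f (μ - β * n))
    (g' := fun (n : ℕ) y => n * y ^ (n - 1) / n.factorial * f (μ - β * n))
    (hf.hasSum_deriv μ (|z| + 1)).summable.abs Metric.isOpen_ball
    (convex_ball (0 : ℝ) (|z| + 1)).isPreconnected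
    (fun n y _ => ((hasDerivAt_pow n y).div_const _).mul_const _) (fun n y hy => ?_)
    (t := Metric.ball 0 (|z| + 1)) (y₀ := z) (by simp) (hf μ z) (by simp)
  rw [mem_ball_zero_iff, Real.norm_eq_abs] at hy
  simp only [Real.norm_eq_abs, abs_mul, abs_div, abs_pow,
    abs_of_nonneg (by positivity : 0 ≤ |z| + 1)]
  gcongr

end ExpShiftSummable

/-! ### The discrete analogue of the Wright function -/

/-- The coefficient of `x ^ k` in `(1 - x) ^ (-μ) * exp (-l * (1 - x) ^ β)`; with `l = t * k ^ β` it
approximates `k ^ (μ - 1) * φ(-β, μ; -t)`. -/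
noncomputable def discreteWright (β μ l : ℝ) (k : ℕ) : ℝ :=
  expShift (Ring.multichoose · k) β μ (-l)

theorem summable_prod_expShift_multichoose (β μ z : ℝ) {x : ℝ} (hx0 : 0 ≤ x) (hx1 : x < 1) :
    Summable fun p : ℕ × ℕ =>
      z ^ p.1 / p.1.factorial * Ring.multichoose (μ - β * p.1) p.2 * x ^ p.2 := by
  have hx : |x| < 1 := by rwa [abs_of_nonneg hx0]
  have hrow (n : ℕ) : HasSum
      (fun k : ℕ => |z| ^ n / n.factorial * (Ring.multichoose |μ - β * n| k * x ^ k))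
      (|z| ^ n / n.factorial * (1 - x) ^ (-|μ - β * n|)) :=
    (hasSum_multichoose_mul_pow _ hx).mul_left _
  have hexp : ExpShiftSummable (fun s => (1 - x) ^ (-|s|)) β := by
    refine expShiftSummable_of_abs_le_exp (C := 1) (A := -Real.log (1 - x)) (fun s => ?_) β
    rw [Real.rpow_def_of_pos (by linarith), Real.abs_exp, one_mul, neg_mul, mul_neg]
  have hmajorant : Summable fun p : ℕ × ℕ =>
      |z| ^ p.1 / p.1.factorial * (Ring.multichoose |μ - β * p.1| p.2 * x ^ p.2) := by
    rw [summable_prod_of_nonneg fun p => by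
      have := multichoose_nonneg (abs_nonneg (μ - β * p.1)) p.2
      dsimp only [Pi.zero_apply]
      positivity]
    exact ⟨fun n => (hrow n).summable, by simpa only [(hrow _).tsum_eq] using hexp μ |z|⟩
  refine hmajorant.of_norm_bounded fun p => ?_
  rw [norm_mul, norm_mul, norm_div, norm_pow, norm_pow, Real.norm_natCast,
    Real.norm_of_nonneg hx0, Real.norm_eq_abs, Real.norm_eq_abs, mul_assoc]
  gcongr
  exact abs_multichoose_le le_rfl p.2

theorem expShiftSummable_multichoose (k : ℕ) (β : ℝ) :
    ExpShiftSummable (Ring.multichoose · k) β := by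
  intro μ z
  have hcol := (summable_prod_expShift_multichoose β μ z (x := 1 / 2) (by norm_num)
    (by norm_num)).comp_injective (Prod.mk_left_injective k)
  refine (hcol.mul_right (((1 / 2 : ℝ) ^ k)⁻¹)).congr fun n => ?_
  rw [Function.comp_apply, mul_inv_cancel_right₀ (by positivity)]

theorem hasSum_discreteWright_mul_pow (β μ l : ℝ) {x : ℝ} (hx0 : 0 ≤ x) (hx1 : x < 1) :
    HasSum (fun k => discreteWright β μ l k * x ^ k)
      ((1 - x) ^ (-μ) * Real.exp (-l * (1 - x) ^ β)) := by
  have hx : |x| < 1 := by rwa [abs_of_nonneg hx0]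
  have hprod := (summable_prod_expShift_multichoose β μ (-l) hx0 hx1).hasSum
  have hcol (k : ℕ) := ((expShiftSummable_multichoose k β).hasSum μ (-l)).mul_right (x ^ k)
  have hrow (n : ℕ) : HasSum
      (fun k : ℕ => (-l) ^ n / n.factorial * Ring.multichoose (μ - β * n) k * x ^ k)
      ((1 - x) ^ (-μ) * ((-l * (1 - x) ^ β) ^ n / n.factorial)) := by
    have hx1' : 0 < 1 - x := by linarith
    have hvalue : (1 - x) ^ (-μ) * ((-l * (1 - x) ^ β) ^ n / n.factorial) =
        (-l) ^ n / n.factorial * (1 - x) ^ (-(μ - β * n)) := by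
      rw [neg_sub', sub_neg_eq_add, Real.rpow_add hx1', Real.rpow_mul_natCast hx1'.le, mul_pow]
      ring
    simpa only [hvalue, mul_assoc] using
      (hasSum_multichoose_mul_pow (μ - β * n) hx).mul_left ((-l) ^ n / n.factorial)
  have hexp : HasSum (fun n : ℕ => (1 - x) ^ (-μ) * ((-l * (1 - x) ^ β) ^ n / n.factorial))
      ((1 - x) ^ (-μ) * Real.exp (-l * (1 - x) ^ β)) := by
    refine HasSum.mul_left _ ?_
    rw [Real.exp_eq_exp_ℝ]
    exact NormedSpace.expSeries_div_hasSum_exp _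
  rw [← (hprod.prod_fiberwise hrow).unique hexp]
  exact ((Equiv.prodComm ℕ ℕ).hasSum_iff.2 hprod).prod_fiberwise hcol

theorem discreteWright_add (β μ ν l : ℝ) (k : ℕ) :
    discreteWright β (ν + μ) l k = ∑ ij ∈ Finset.HasAntidiagonal.antidiagonal k,
      Ring.multichoose ν ij.1 * discreteWright β μ l ij.2 := by
  have hsum := hasSum_sum (s := Finset.HasAntidiagonal.antidiagonal k) fun ij _ =>
    ((expShiftSummable_multichoose ij.2 β).hasSum μ (-l)).mul_left (Ring.multichoose ν ij.1)
  refine Eq.trans (tsum_congr fun n => ?_) hsum.tsum_eq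
  dsimp only
  rw [add_sub_assoc, multichoose_add, Finset.mul_sum]
  exact Finset.sum_congr rfl fun _ _ => mul_left_comm _ _ _

theorem discreteWright_zero_right (β μ l : ℝ) : discreteWright β μ l 0 = Real.exp (-l) := by
  simp only [discreteWright, Ring.multichoose_zero_right, expShift_const, mul_one]

theorem succ_mul_discreteWright_zero_succ (β l : ℝ) (k : ℕ) :
    (k + 1) * discreteWright β 0 l (k + 1) = l * β * discreteWright β (1 - β) l k := by
  have hrec := (expShiftSummable_multichoose k β).recurrence
    (fun s => succ_mul_multichoose_succ' s k) 0 (-l)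
  rw [discreteWright, discreteWright, expShift, ← tsum_mul_left]
  simp only [expShift, mul_left_comm ((k : ℝ) + 1)] at hrec ⊢
  rw [hrec, zero_mul, zero_sub, zero_add]
  ring

theorem discreteWright_nonneg {β μ l : ℝ} (hβ0 : 0 ≤ β) (hβ1 : β ≤ 1) (hμ : 0 ≤ μ) (hl : 0 ≤ l)
    (k : ℕ) : 0 ≤ discreteWright β μ l k := by
  have hshift (ν : ℝ) (hν : 0 ≤ ν) (k : ℕ) (h0 : ∀ j ≤ k, 0 ≤ discreteWright β 0 l j) :
      0 ≤ discreteWright β ν l k := by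
    rw [← add_zero ν, discreteWright_add]
    exact Finset.sum_nonneg fun ij hij => mul_nonneg (multichoose_nonneg hν _)
      (h0 _ (Finset.HasAntidiagonal.antidiagonal.snd_le hij))
  have hzero (j : ℕ) : 0 ≤ discreteWright β 0 l j := by
    induction j using Nat.strong_induction_on with
    | _ j ih =>
      rcases j with _ | j
      · rw [discreteWright_zero_right]
        positivity
      · have hpred : 0 ≤ discreteWright β (1 - β) l j :=
          hshift _ (sub_nonneg.2 hβ1) j fun i hi => ih i (Nat.lt_succ_of_le hi)
        refine nonneg_of_mul_nonneg_right (a := (j : ℝ) + 1) ?_ (by positivity)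
        rw [succ_mul_discreteWright_zero_succ]
        positivity
  exact hshift μ hμ k fun j _ => hzero j

theorem discreteWright_one_add (β μ l : ℝ) (k : ℕ) :
    discreteWright β (1 + μ) l k = ∑ j ∈ Finset.range (k + 1), discreteWright β μ l j := by
  rw [discreteWright_add]
  simp only [Ring.multichoose_one, one_mul]
  rw [Finset.Nat.sum_antidiagonal_eq_sum_range_succ_mk]
  exact Finset.sum_range_reflect (discreteWright β μ l) (k + 1)

theorem pow_mul_discreteWright_le {β μ l x : ℝ} (hβ0 : 0 ≤ β) (hβ1 : β ≤ 1) (hμ : 1 ≤ μ)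
    (hl : 0 ≤ l) (hx0 : 0 ≤ x) (hx1 : x < 1) (k : ℕ) :
    x ^ k * discreteWright β μ l k ≤ (1 - x) ^ (1 - μ) * Real.exp (-l * (1 - x) ^ β) := by
  have hnonneg := discreteWright_nonneg hβ0 hβ1 (sub_nonneg.2 hμ) hl
  calc x ^ k * discreteWright β μ l k
      = ∑ j ∈ Finset.range (k + 1), discreteWright β (μ - 1) l j * x ^ k := by
        rw [← Finset.sum_mul, ← discreteWright_one_add, add_sub_cancel, mul_comm]
    _ ≤ ∑ j ∈ Finset.range (k + 1), discreteWright β (μ - 1) l j * x ^ j :=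
        Finset.sum_le_sum fun j hj => mul_le_mul_of_nonneg_left
          (pow_le_pow_of_le_one hx0 hx1.le (Finset.mem_range_succ_iff.1 hj)) (hnonneg j)
    _ ≤ (1 - x) ^ (-(μ - 1)) * Real.exp (-l * (1 - x) ^ β) :=
        sum_le_hasSum _ (fun j _ => mul_nonneg (hnonneg j) (by positivity))
          (hasSum_discreteWright_mul_pow β (μ - 1) l hx0 hx1)
    _ = _ := by rw [neg_sub]

/-! ### The Wright function as a limit of its discrete analogues -/

theorem wrightPhi_eq_expShift (β μ z : ℝ) :
    wrightPhi (-β) μ z = expShift (fun s => (Real.Gamma s)⁻¹) β μ z := by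
  refine tsum_congr fun n => ?_
  rw [neg_mul, neg_add_eq_sub, div_mul_eq_div_div, div_eq_mul_inv _ (Real.Gamma _)]

section

variable {β : ℝ} (hβ0 : 0 ≤ β)
include hβ0

theorem rpow_mul_abs_multichoose_sub_le (μ : ℝ) (n : ℕ) {k : ℕ} (hk : 0 < k) :
    (k : ℝ) ^ (1 - (μ - β * n)) * |Ring.multichoose (μ - β * n) k| ≤
      Real.exp (4 * (β * n + (|1 - μ| + 1))) *
        (β * n + (|1 - μ| + 1)) ^ (β * n + (|1 - μ| + 1)) := by
  have hβn : 0 ≤ β * n := by positivity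
  have hy : |1 - (μ - β * n)| ≤ β * n + (|1 - μ| + 1) := by
    have := abs_add_le (1 - μ) (β * n)
    rw [abs_of_nonneg hβn] at this
    rw [sub_sub_eq_add_sub, add_sub_right_comm]
    linarith
  simpa only [sub_sub_cancel] using
    rpow_mul_abs_multichoose_one_sub_le (by linarith [abs_nonneg (1 - μ)]) hy hk

theorem abs_inv_Gamma_sub_le (μ : ℝ) (n : ℕ) :
    |(Real.Gamma (μ - β * n))⁻¹| ≤ Real.exp (4 * (β * n + (|1 - μ| + 1))) *
      (β * n + (|1 - μ| + 1)) ^ (β * n + (|1 - μ| + 1)) := by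
  refine le_of_tendsto (tendsto_rpow_mul_multichoose (μ - β * n)).abs ?_
  filter_upwards [eventually_gt_atTop 0] with k hk
  rw [abs_mul, abs_of_nonneg (by positivity)]
  exact rpow_mul_abs_multichoose_sub_le hβ0 μ n hk

variable (hβ1 : β < 1)
include hβ1

theorem expShiftSummable_inv_Gamma : ExpShiftSummable (fun s => (Real.Gamma s)⁻¹) β := by
  intro μ z
  refine (summable_pow_div_factorial_mul_exp_mul_rpow hβ0 hβ1
    (by positivity : 0 < |1 - μ| + 1) |z| 4).of_norm_bounded fun n => ?_
  rw [norm_mul, norm_div, norm_pow, Real.norm_natCast, Real.norm_eq_abs, Real.norm_eq_abs]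
  gcongr
  exact abs_inv_Gamma_sub_le hβ0 μ n

theorem tendsto_rpow_mul_discreteWright (μ t : ℝ) :
    Tendsto (fun k : ℕ => (k : ℝ) ^ (1 - μ) * discreteWright β μ (t * (k : ℝ) ^ β) k) atTop
      (𝓝 (wrightPhi (-β) μ (-t))) := by
  have hlim : Tendsto
      (fun k : ℕ => expShift (fun s => (k : ℝ) ^ (1 - s) * Ring.multichoose s k) β μ (-t))
      atTop (𝓝 (wrightPhi (-β) μ (-t))) := by
    rw [wrightPhi_eq_expShift]
    refine tendsto_tsum_of_dominated_convergence
      (summable_pow_div_factorial_mul_exp_mul_rpow hβ0 hβ1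
        (by positivity : 0 < |1 - μ| + 1) |t| 4)
      (fun n => (tendsto_rpow_mul_multichoose (μ - β * n)).const_mul _) ?_
    filter_upwards [eventually_gt_atTop 0] with k hk n
    rw [norm_mul, norm_div, norm_pow, norm_neg, Real.norm_natCast, norm_mul, Real.norm_eq_abs,
      Real.norm_of_nonneg (by positivity), Real.norm_eq_abs]
    exact mul_le_mul_of_nonneg_left (rpow_mul_abs_multichoose_sub_le hβ0 μ n hk) (by positivity)
  refine hlim.congr' ?_
  filter_upwards [eventually_gt_atTop 0] with k hk
  rw [expShift_rescale _ _ _ _ (by exact_mod_cast hk), discreteWright, neg_mul]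

theorem wrightPhi_neg_nonneg {μ t : ℝ} (hμ : 0 ≤ μ) (ht : 0 ≤ t) : 0 ≤ wrightPhi (-β) μ (-t) :=
  ge_of_tendsto' (tendsto_rpow_mul_discreteWright hβ0 hβ1 μ t) fun _ =>
    mul_nonneg (by positivity) (discreteWright_nonneg hβ0 hβ1.le hμ (by positivity) _)

/-! ### Chernoff bounds -/

theorem wrightPhi_neg_le {μ t c : ℝ} (hμ : 1 ≤ μ) (ht : 0 ≤ t) (hc : 0 < c) :
    wrightPhi (-β) μ (-t) ≤ c ^ (1 - μ) * Real.exp (c - t * c ^ β) := by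
  have hpow : Tendsto (fun k : ℕ => (1 + -c / (k : ℝ)) ^ k) atTop (𝓝 (Real.exp (-c))) :=
    Real.tendsto_one_add_div_pow_exp (-c)
  have hlim := hpow.mul (tendsto_rpow_mul_discreteWright hβ0 hβ1 μ t)
  have hbound : Real.exp (-c) * wrightPhi (-β) μ (-t) ≤
      c ^ (1 - μ) * Real.exp (-(t * c ^ β)) := by
    refine le_of_tendsto hlim ?_
    filter_upwards [(tendsto_natCast_atTop_atTop (R := ℝ)).eventually_gt_atTop c] with k hk
    have hk0 : 0 < (k : ℝ) := hc.trans hk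
    have hck : 0 < c / k := by positivity
    have hck1 : c / k < 1 := (div_lt_one hk0).2 hk
    have hchernoff := pow_mul_discreteWright_le hβ0 hβ1.le (l := t * (k : ℝ) ^ β) hμ
      (by positivity) (sub_nonneg.2 hck1.le) (sub_lt_self 1 hck) k
    rw [sub_sub_cancel, Real.div_rpow hc.le hk0.le, Real.div_rpow hc.le hk0.le, neg_mul, mul_assoc,
      mul_div_cancel₀ _ (by positivity)] at hchernoff
    calc (1 + -c / (k : ℝ)) ^ k * ((k : ℝ) ^ (1 - μ) * discreteWright β μ (t * (k : ℝ) ^ β) k)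
        = (k : ℝ) ^ (1 - μ) * ((1 - c / k) ^ k * discreteWright β μ (t * (k : ℝ) ^ β) k) := by
          rw [neg_div, ← sub_eq_add_neg]
          ring
      _ ≤ (k : ℝ) ^ (1 - μ) *
            (c ^ (1 - μ) / (k : ℝ) ^ (1 - μ) * Real.exp (-(t * c ^ β))) := by gcongr
      _ = c ^ (1 - μ) * Real.exp (-(t * c ^ β)) := by
          field_simp
  calc wrightPhi (-β) μ (-t) = Real.exp c * (Real.exp (-c) * wrightPhi (-β) μ (-t)) := by
        rw [← mul_assoc, ← Real.exp_add, add_neg_cancel, Real.exp_zero, one_mul]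
    _ ≤ Real.exp c * (c ^ (1 - μ) * Real.exp (-(t * c ^ β))) := by gcongr
    _ = c ^ (1 - μ) * Real.exp (c - t * c ^ β) := by rw [sub_eq_add_neg c, Real.exp_add]; ring

theorem wrightPhi_neg_recurrence (μ t : ℝ) :
    wrightPhi (-β) μ (-t) =
      μ * wrightPhi (-β) (μ + 1) (-t) + β * t * wrightPhi (-β) (μ + 1 - β) (-t) := by
  have hGamma (s : ℝ) : (Real.Gamma s)⁻¹ = s * (Real.Gamma (s + 1))⁻¹ := by
    rcases eq_or_ne s 0 with rfl | hs
    · simp [Real.Gamma_zero]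
    · rw [Real.Gamma_add_one hs, mul_inv, mul_inv_cancel_left₀ hs]
  simp only [wrightPhi_eq_expShift]
  rw [(expShiftSummable_inv_Gamma hβ0 hβ1).recurrence hGamma]
  ring

theorem wrightPhi_neg_le_pow_mul {t c : ℝ} (ht : 0 ≤ t) (hc : 1 ≤ c) (N : ℕ) {μ : ℝ}
    (hμ : 0 ≤ μ) (hN : 1 ≤ μ + N * (1 - β)) :
    wrightPhi (-β) μ (-t) ≤ (1 + t) ^ N * Real.exp (c - t * c ^ β) := by
  set D := Real.exp (c - t * c ^ β)
  have hlarge {μ : ℝ} (hμ : 1 ≤ μ) : wrightPhi (-β) μ (-t) ≤ D :=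
    (wrightPhi_neg_le hβ0 hβ1 hμ ht (zero_lt_one.trans_le hc)).trans
      (mul_le_of_le_one_left (Real.exp_nonneg _)
        (Real.rpow_le_one_of_one_le_of_nonpos hc (sub_nonpos.2 hμ)))
  induction N generalizing μ with
  | zero => simpa using hlarge (by simpa using hN)
  | succ N ih =>
    have hpow (m : ℕ) : D ≤ (1 + t) ^ m * D :=
      le_mul_of_one_le_left (Real.exp_nonneg _) (one_le_pow₀ (by linarith))
    rcases le_or_gt 1 μ with h1μ | hμ1
    · exact (hlarge h1μ).trans (hpow _)
    · have hnext : wrightPhi (-β) (μ + 1 - β) (-t) ≤ (1 + t) ^ N * D :=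
        ih (by linarith) (by push_cast at hN; linarith)
      have hnext0 : 0 ≤ wrightPhi (-β) (μ + 1 - β) (-t) :=
        wrightPhi_neg_nonneg hβ0 hβ1 (by linarith) ht
      have hsucc0 : 0 ≤ wrightPhi (-β) (μ + 1) (-t) :=
        wrightPhi_neg_nonneg hβ0 hβ1 (by linarith) ht
      calc wrightPhi (-β) μ (-t)
          ≤ 1 * wrightPhi (-β) (μ + 1) (-t) + 1 * t * wrightPhi (-β) (μ + 1 - β) (-t) := by
            rw [wrightPhi_neg_recurrence hβ0 hβ1]
            gcongr
        _ ≤ 1 * ((1 + t) ^ N * D) + 1 * t * ((1 + t) ^ N * D) := by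
            gcongr
            exact (hlarge (by linarith)).trans (hpow N)
        _ = (1 + t) ^ (N + 1) * D := by ring

end

theorem wrightPhi_neg_le_exp {β : ℝ} (hβ0 : 0 < β) (hβ1 : β < 1) {μ t : ℝ} (hμ : 1 - β ≤ μ)
    (ht : 1 ≤ β * t) :
    wrightPhi (-β) μ (-t) ≤
      Real.exp (1 / (1 - β) * t - (1 - β) * (β * t) ^ (1 / (1 - β))) := by
  have hβ' : 0 < 1 - β := sub_pos.2 hβ1
  have ht0 : 0 < t := pos_of_mul_pos_right (zero_lt_one.trans_le ht) hβ0.le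
  set p : ℝ := 1 / (1 - β) with hp
  have hp0 : 0 < p := by positivity
  have hpβ : p * β = p - 1 := by rw [hp]; field_simp; ring
  -- This `c` minimises `c - t * c ^ β`.
  set c : ℝ := (β * t) ^ p with hc
  have hc1 : 1 ≤ c := Real.one_le_rpow ht hp0.le
  have hcβ : t * c ^ β = c / β := by
    rw [hc, ← Real.rpow_mul (by positivity), hpβ, Real.rpow_sub_one (by positivity)]
    field_simp
  have hexponent : c - t * c ^ β ≤ -((1 - β) * c) := by
    have hβinv : 2 - β ≤ 1 / β := by
      rw [le_div_iff₀ hβ0]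
      linarith [sq_nonneg (1 - β)]
    have := mul_le_mul_of_nonneg_right hβinv (zero_le_one.trans hc1)
    rw [hcβ]
    linarith [one_div_mul_eq_div β c]
  have hN : 1 ≤ μ + (⌈p * β⌉₊ : ℝ) * (1 - β) := by
    have := mul_le_mul_of_nonneg_right (Nat.le_ceil (p * β)) hβ'.le
    have hpβ' : p * β * (1 - β) = β := by rw [hp]; field_simp
    linarith
  have hNp : (⌈p * β⌉₊ : ℝ) ≤ p := by
    linarith [Nat.ceil_lt_add_one (a := p * β) (by positivity)]
  calc wrightPhi (-β) μ (-t) ≤ (1 + t) ^ ⌈p * β⌉₊ * Real.exp (c - t * c ^ β) :=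
        wrightPhi_neg_le_pow_mul hβ0.le hβ1 ht0.le hc1 _ (hβ'.le.trans hμ) hN
    _ ≤ Real.exp t ^ ⌈p * β⌉₊ * Real.exp (-((1 - β) * c)) := by
        gcongr
        linarith [Real.add_one_le_exp t]
    _ ≤ Real.exp (p * t) * Real.exp (-((1 - β) * c)) := by
        rw [← Real.exp_nat_mul]
        gcongr
    _ = Real.exp (p * t - (1 - β) * c) := by rw [← Real.exp_add, ← sub_eq_add_neg]

/-! ### Total mass -/

theorem hasDerivAt_wrightPhi_neg {β : ℝ} (hβ0 : 0 ≤ β) (hβ1 : β < 1) (μ t : ℝ) :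
    HasDerivAt (fun t => wrightPhi (-β) μ (-t)) (-wrightPhi (-β) (μ - β) (-t)) t := by
  simp only [wrightPhi_eq_expShift]
  rw [← mul_neg_one]
  exact ((expShiftSummable_inv_Gamma hβ0 hβ1).hasDerivAt μ (-t)).comp t (hasDerivAt_neg t)

theorem continuous_wrightPhi_neg {β : ℝ} (hβ0 : 0 ≤ β) (hβ1 : β < 1) (μ : ℝ) :
    Continuous fun t => wrightPhi (-β) μ (-t) :=
  continuous_iff_continuousAt.2 fun t => (hasDerivAt_wrightPhi_neg hβ0 hβ1 μ t).continuousAt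

theorem intervalIntegral_wrightPhi_neg {β : ℝ} (hβ0 : 0 ≤ β) (hβ1 : β < 1) (T : ℝ) :
    ∫ t in (0 : ℝ)..T, wrightPhi (-β) (1 - β) (-t) = 1 - wrightPhi (-β) 1 (-T) := by
  have hderiv (t : ℝ) :
      HasDerivAt (fun t => -wrightPhi (-β) 1 (-t)) (wrightPhi (-β) (1 - β) (-t)) t := by
    simpa only [neg_neg] using (hasDerivAt_wrightPhi_neg hβ0 hβ1 1 t).fun_neg
  have hzero : wrightPhi (-β) 1 0 = 1 := by
    rw [wrightPhi_eq_expShift, expShift_zero, Real.Gamma_one, inv_one]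
  rw [intervalIntegral.integral_eq_sub_of_hasDerivAt (fun t _ => hderiv t)
    ((continuous_wrightPhi_neg hβ0 hβ1 _).intervalIntegrable _ _), neg_zero, hzero]
  ring

/-! ### Concentration at `1` -/

theorem inv_Gamma_one_sub {s : ℝ} (hs : Real.Gamma s ≠ 0) :
    (Real.Gamma (1 - s))⁻¹ = Real.Gamma s * Real.sin (Real.pi * s) / Real.pi := by
  rw [eq_div_of_mul_eq hs ((mul_comm _ _).trans (Real.Gamma_mul_Gamma_one_sub s)), inv_div,
    div_div_eq_mul_div]

theorem Gamma_add_one_le_factorial {x : ℝ} {m : ℕ} (hx : 0 ≤ x) (hxm : x ≤ m) :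
    Real.Gamma (x + 1) ≤ m.factorial := by
  have h := Real.convexOn_Gamma.le_max_of_mem_Icc (z := x + 1) (mem_Ioi.2 one_pos)
    (mem_Ioi.2 (by positivity : (0 : ℝ) < m + 1)) ⟨by linarith, by linarith⟩
  rw [Real.Gamma_one, Real.Gamma_nat_eq_factorial] at h
  exact h.trans_eq (max_eq_right (by exact_mod_cast Nat.one_le_iff_ne_zero.2 m.factorial_ne_zero))

theorem abs_sin_pi_mul_mul_nat_le (β : ℝ) (m : ℕ) :
    |Real.sin (Real.pi * (β * m))| ≤ Real.pi * (|1 - β| * m) := by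
  calc |Real.sin (Real.pi * (β * m))| = |Real.sin (Real.pi * ((1 - β) * m))| := by
        rw [show Real.pi * (β * m) = m * Real.pi - Real.pi * ((1 - β) * m) by ring,
          Real.sin_nat_mul_pi_sub, abs_neg, abs_mul, abs_neg_one_pow, one_mul]
    _ ≤ |Real.pi * ((1 - β) * m)| := Real.abs_sin_le_abs
    _ = Real.pi * (|1 - β| * m) := by
        rw [abs_mul, abs_mul, abs_of_pos Real.pi_pos, Nat.abs_cast]

theorem abs_inv_Gamma_one_sub_mul_le {β : ℝ} (hβ0 : 0 < β) (hβ1 : β ≤ 1) {m : ℕ} (hm : 0 < m) :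
    |(Real.Gamma (1 - β * m))⁻¹| ≤ (1 - β) / β * m.factorial := by
  have hm0 : (0 : ℝ) < m := by exact_mod_cast hm
  have hΓpos : 0 < Real.Gamma (β * m) := Real.Gamma_pos_of_pos (by positivity)
  have hΓ : Real.Gamma (β * m) * (β * m) ≤ m.factorial := by
    rw [mul_comm, ← Real.Gamma_add_one (by positivity)]
    exact Gamma_add_one_le_factorial (by positivity) (mul_le_of_le_one_left hm0.le hβ1)
  have hsin := abs_sin_pi_mul_mul_nat_le β m
  rw [abs_of_nonneg (sub_nonneg.2 hβ1)] at hsin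
  rw [inv_Gamma_one_sub hΓpos.ne', abs_div, abs_mul, abs_of_pos Real.pi_pos, abs_of_pos hΓpos,
    div_le_iff₀ Real.pi_pos]
  calc Real.Gamma (β * m) * |Real.sin (Real.pi * (β * m))|
      ≤ Real.Gamma (β * m) * (Real.pi * ((1 - β) * m)) := by gcongr
    _ = (1 - β) / β * (Real.Gamma (β * m) * (β * m)) * Real.pi := by field_simp
    _ ≤ (1 - β) / β * m.factorial * Real.pi := by
        have := sub_nonneg.2 hβ1
        gcongr

theorem wrightPhi_neg_le_of_lt_one {β : ℝ} (hβ0 : 0 < β) (hβ1 : β < 1) {t : ℝ} (ht0 : 0 ≤ t)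
    (ht1 : t < 1) :
    wrightPhi (-β) (1 - β) (-t) ≤ (1 - β) / β * (1 / (1 - t) ^ 2) := by
  have hmajorant := (hasSum_choose_mul_geometric_of_norm_lt_one 1 (r := t)
    (by rwa [Real.norm_of_nonneg ht0])).mul_left ((1 - β) / β)
  rw [wrightPhi_eq_expShift]
  refine hasSum_le (fun n => ?_)
    ((expShiftSummable_inv_Gamma hβ0.le hβ1).hasSum (1 - β) (-t)) hmajorant
  have hΓ := abs_inv_Gamma_one_sub_mul_le hβ0 hβ1.le n.succ_pos
  rw [Nat.cast_succ, mul_add_one, ← sub_sub, sub_right_comm, Nat.factorial_succ] at hΓ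
  calc (-t) ^ n / n.factorial * (Real.Gamma (1 - β - β * n))⁻¹
      ≤ |(-t) ^ n / n.factorial * (Real.Gamma (1 - β - β * n))⁻¹| := le_abs_self _
    _ = t ^ n / n.factorial * |(Real.Gamma (1 - β - β * n))⁻¹| := by
        rw [abs_mul, abs_div, abs_pow, abs_neg, abs_of_nonneg ht0, Nat.abs_cast]
    _ ≤ t ^ n / n.factorial * ((1 - β) / β * ((n + 1) * n.factorial : ℕ)) := by gcongr
    _ = (1 - β) / β * ((n + 1).choose 1 * t ^ n) := by
        rw [Nat.choose_one_right]
        push_cast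
        field_simp

theorem quarter_le_rpow_one_div_one_sub {β : ℝ} (hβ : 1 / 2 ≤ β) (hβ1 : β < 1) :
    1 / 4 ≤ β ^ (1 / (1 - β)) := by
  have hβ' : 0 < 1 - β := sub_pos.2 hβ1
  have hbernoulli : 1 / 2 ≤ β ^ (1 / (1 - β) / 2) := by
    have h := one_add_mul_self_le_rpow_one_add (s := β - 1) (p := 1 / (1 - β) / 2) (by linarith)
      (by rw [div_div, le_div_iff₀ (by positivity)]; linarith)
    rw [add_sub_cancel] at h
    refine le_trans (le_of_eq ?_) h
    rw [← neg_sub 1 β]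
    field_simp
    norm_num
  calc (1 : ℝ) / 4 = (1 / 2) ^ 2 := by norm_num
    _ ≤ (β ^ (1 / (1 - β) / 2)) ^ 2 := by gcongr
    _ = β ^ (1 / (1 - β)) := by
        rw [← Real.rpow_mul_natCast (by linarith), Nat.cast_ofNat, div_mul_cancel₀ _ two_ne_zero]

theorem eventually_forall_mul_add_mul_rpow_le {a : ℝ} (ha : 1 < a) (A K : ℝ) :
    ∀ᶠ p : ℝ in atTop, ∀ t, a ≤ t → p * t + A * t ^ K ≤ t ^ p / (4 * p) := by
  set k : ℝ := max K 1
  have ha0 : 0 < a := zero_lt_one.trans ha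
  have hbase : ∀ᶠ p : ℝ in atTop, 4 * p * (p + |A|) * a ^ k ≤ a ^ p := by
    have hsmall := (isLittleO_pow_exp_pos_mul_atTop 2 (Real.log_pos ha)).bound
      (by positivity : 0 < 1 / (8 * a ^ k))
    filter_upwards [hsmall, eventually_ge_atTop |A|, eventually_gt_atTop 0] with p hp hAp hp0
    rw [Real.norm_of_nonneg (by positivity), Real.norm_of_nonneg (by positivity),
      ← Real.rpow_def_of_pos ha0, one_div_mul_eq_div, le_div_iff₀ (by positivity)] at hp
    calc 4 * p * (p + |A|) * a ^ k ≤ 4 * p * (p + p) * a ^ k := by gcongr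
      _ = p ^ 2 * (8 * a ^ k) := by ring
      _ ≤ a ^ p := hp
  filter_upwards [hbase, eventually_ge_atTop k, eventually_gt_atTop 0] with p hp hkp hp0 t hat
  have ht0 : 0 < t := ha0.trans_le hat
  have ht1 : 1 ≤ t := ha.le.trans hat
  have hratio : 4 * p * (p + |A|) ≤ t ^ (p - k) :=
    calc 4 * p * (p + |A|) ≤ a ^ p / a ^ k := (le_div_iff₀ (by positivity)).2 hp
      _ = a ^ (p - k) := (Real.rpow_sub ha0 p k).symm
      _ ≤ t ^ (p - k) := Real.rpow_le_rpow ha0.le hat (sub_nonneg.2 hkp)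
  rw [le_div_iff₀ (by positivity)]
  calc (p * t + A * t ^ K) * (4 * p) ≤ (p * t ^ k + |A| * t ^ k) * (4 * p) := by
        gcongr
        · exact Real.self_le_rpow_of_one_le ht1 (le_max_right _ _)
        · exact le_abs_self A
        · exact le_max_left _ _
    _ = 4 * p * (p + |A|) * t ^ k := by ring
    _ ≤ t ^ (p - k) * t ^ k := by gcongr
    _ = t ^ p := by rw [← Real.rpow_add ht0, sub_add_cancel]

theorem tendsto_one_div_one_sub_atTop : Tendsto (fun β : ℝ => 1 / (1 - β)) (𝓝[<] 1) atTop := by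
  simp_rw [one_div]
  refine tendsto_inv_nhdsGT_zero.comp (tendsto_nhdsWithin_iff.2 ⟨?_, ?_⟩)
  · exact ((continuous_sub_left (1 : ℝ)).tendsto' 1 0 (sub_self 1)).mono_left nhdsWithin_le_nhds
  · filter_upwards [self_mem_nhdsWithin] with β hβ using sub_pos.2 (mem_Iio.1 hβ)

theorem eventually_wrightPhi_neg_le_exp {a : ℝ} (ha : 1 < a) (A K : ℝ) :
    ∀ᶠ β : ℝ in 𝓝[<] 1, ∀ μ, 1 - β ≤ μ → ∀ t, a ≤ t →
      wrightPhi (-β) μ (-t) ≤ Real.exp (-(A * t ^ K)) := by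
  have hβa : ∀ᶠ β : ℝ in 𝓝[<] 1, 1 ≤ β * a :=
    ((continuous_mul_const a).tendsto' 1 a (one_mul a)).mono_left nhdsWithin_le_nhds
      |>.eventually (eventually_ge_nhds ha)
  filter_upwards [tendsto_one_div_one_sub_atTop.eventually
      (eventually_forall_mul_add_mul_rpow_le ha A K), hβa,
    Ico_mem_nhdsLT (by norm_num : (1 / 2 : ℝ) < 1)] with β hp hβa ⟨hβ, hβ1⟩ μ hμ t hat
  have hβ0 : 0 < β := by linarith
  have : 0 < 1 - β := sub_pos.2 hβ1
  have ht0 : 0 ≤ t := by linarith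
  refine (wrightPhi_neg_le_exp hβ0 hβ1 hμ (hβa.trans (by gcongr))).trans (Real.exp_le_exp.2 ?_)
  have hlower : t ^ (1 / (1 - β)) / (4 * (1 / (1 - β))) ≤ (1 - β) * (β * t) ^ (1 / (1 - β)) :=
    calc t ^ (1 / (1 - β)) / (4 * (1 / (1 - β)))
        = (1 - β) * (1 / 4 * t ^ (1 / (1 - β))) := by field_simp
      _ ≤ (1 - β) * (β ^ (1 / (1 - β)) * t ^ (1 / (1 - β))) := by
          gcongr
          exact quarter_le_rpow_one_div_one_sub hβ hβ1
      _ = (1 - β) * (β * t) ^ (1 / (1 - β)) := by rw [Real.mul_rpow hβ0.le ht0]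
  linarith [hp t hat]

theorem eventually_wrightPhi_neg_lt {a : ℝ} (ha : 1 < a) {ε : ℝ} (hε : 0 < ε) :
    ∀ᶠ β : ℝ in 𝓝[<] 1, ∀ μ, 1 - β ≤ μ → ∀ t, a ≤ t → wrightPhi (-β) μ (-t) < ε := by
  filter_upwards [eventually_wrightPhi_neg_le_exp ha (1 - Real.log ε) 0] with β hβ μ hμ t hat
  refine (hβ μ hμ t hat).trans_lt ?_
  rw [Real.rpow_zero, mul_one, ← Real.lt_log_iff_exp_lt hε]
  linarith

theorem tendsto_wrightPhi_neg_of_one_lt {t : ℝ} (ht : 1 < t) {μ : ℝ → ℝ}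
    (hμ : ∀ᶠ β in 𝓝[<] 1, 1 - β ≤ μ β) :
    Tendsto (fun β => wrightPhi (-β) (μ β) (-t)) (𝓝[<] 1) (𝓝 0) := by
  refine tendsto_order.2 ⟨fun ε hε => ?_, fun ε hε => ?_⟩
  · filter_upwards [Ioo_mem_nhdsLT one_pos, hμ] with β ⟨hβ0, hβ1⟩ hμβ
    exact hε.trans_le (wrightPhi_neg_nonneg hβ0.le hβ1 (by linarith) (by linarith))
  · filter_upwards [eventually_wrightPhi_neg_lt ht hε, hμ] with β hβ hμβ
    exact hβ _ hμβ t le_rfl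

theorem tendsto_setIntegral_Ioc_wrightPhi_neg {T : ℝ} (hT : 1 < T) :
    Tendsto (fun β : ℝ => ∫ t in Ioc 0 T, wrightPhi (-β) (1 - β) (-t)) (𝓝[<] 1) (𝓝 1) := by
  have hμ : ∀ᶠ β : ℝ in 𝓝[<] 1, 1 - β ≤ 1 := by
    filter_upwards [Ioo_mem_nhdsLT one_pos] with β ⟨hβ0, _⟩ using sub_le_self 1 hβ0.le
  have htail := (tendsto_wrightPhi_neg_of_one_lt hT hμ).const_sub 1
  rw [sub_zero] at htail
  refine htail.congr' ?_
  filter_upwards [Ioo_mem_nhdsLT one_pos] with β ⟨hβ0, hβ1⟩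
  rw [← intervalIntegral_wrightPhi_neg hβ0.le hβ1,
    intervalIntegral.integral_of_le (zero_le_one.trans hT.le)]

theorem tendstoUniformlyOn_wrightPhi_neg {u : Set ℝ} (hu : u ∈ 𝓝 1) :
    TendstoUniformlyOn (fun β t => wrightPhi (-β) (1 - β) (-t)) 0 (𝓝[<] 1) (Ici 0 \ u) := by
  obtain ⟨r, hr0, hr⟩ := Metric.mem_nhds_iff.1 hu
  refine Metric.tendstoUniformlyOn_iff.2 fun ε hε => ?_
  have hleft : Tendsto (fun β : ℝ => (1 - β) / β * (1 / r ^ 2)) (𝓝[<] 1) (𝓝 0) := by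
    have hcont : ContinuousAt (fun β : ℝ => (1 - β) / β * (1 / r ^ 2)) 1 := by
      fun_prop (disch := exact one_ne_zero)
    simpa using hcont.tendsto.mono_left nhdsWithin_le_nhds
  filter_upwards [eventually_wrightPhi_neg_lt (lt_add_of_pos_right 1 hr0) hε,
    hleft.eventually (gt_mem_nhds hε), Ioo_mem_nhdsLT one_pos]
    with β hright hleft ⟨hβ0, hβ1⟩ t ⟨(ht0 : 0 ≤ t), htu⟩
  have hβ' : 0 ≤ 1 - β := sub_nonneg.2 hβ1.le
  rw [Pi.zero_apply, dist_zero_left,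
    Real.norm_of_nonneg (wrightPhi_neg_nonneg hβ0.le hβ1 hβ' ht0)]
  have hdist : r ≤ |t - 1| := not_lt.1 fun hlt => htu (hr hlt)
  rcases le_abs.1 hdist with hrt | hrt
  · exact hright _ le_rfl t (by linarith)
  · calc wrightPhi (-β) (1 - β) (-t) ≤ (1 - β) / β * (1 / (1 - t) ^ 2) :=
          wrightPhi_neg_le_of_lt_one hβ0 hβ1 ht0 (by linarith)
      _ ≤ (1 - β) / β * (1 / r ^ 2) := by gcongr; linarith
      _ < ε := hleft

/-! ### Integrability and the limit -/

theorem isLittleO_rpow_rpow_atTop {p q : ℝ} (hpq : p < q) :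
    (fun t : ℝ => t ^ p) =o[atTop] fun t => t ^ q := by
  refine (isLittleO_iff_tendsto' ?_).2 ?_
  · filter_upwards [eventually_gt_atTop 0] with t ht h
    exact absurd h (by positivity)
  · refine (tendsto_rpow_neg_atTop (sub_pos.2 hpq)).congr' ?_
    filter_upwards [eventually_gt_atTop 0] with t ht
    rw [neg_sub, Real.rpow_sub ht]

theorem wrightPhi_neg_isBigO_exp {β δ : ℝ} (hβ0 : 0 < β) (hβ1 : β < 1) (hδ : δ < 1 / (1 - β))
    (σ : ℝ) {μ : ℝ} (hμ : 1 - β ≤ μ) :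
    (fun t => wrightPhi (-β) μ (-t)) =O[atTop] fun t => Real.exp (-(σ * t ^ δ + t)) := by
  have hβ' : 0 < 1 - β := sub_pos.2 hβ1
  set p : ℝ := 1 / (1 - β)
  have hp1 : 1 < p := by rw [lt_div_iff₀ hβ']; linarith
  have hlower : (fun t => (p + 1) * t ^ (1 : ℝ) + σ * t ^ δ) =o[atTop] fun t : ℝ => t ^ p :=
    ((isLittleO_rpow_rpow_atTop hp1).const_mul_left _).add
      ((isLittleO_rpow_rpow_atTop hδ).const_mul_left _)
  refine IsBigO.of_bound 1 ?_
  filter_upwards [hlower.bound (by positivity : 0 < (1 - β) * β ^ p), eventually_ge_atTop (1 / β),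
    eventually_gt_atTop 0] with t ht hβt ht0
  rw [Real.rpow_one, Real.norm_of_nonneg (by positivity : 0 ≤ t ^ p), mul_assoc,
    ← Real.mul_rpow hβ0.le ht0.le] at ht
  rw [one_mul, Real.norm_of_nonneg (Real.exp_nonneg _),
    Real.norm_of_nonneg (wrightPhi_neg_nonneg hβ0.le hβ1 (hβ'.le.trans hμ) ht0.le)]
  refine (wrightPhi_neg_le_exp hβ0 hβ1 hμ ((div_le_iff₀' hβ0).1 hβt)).trans ?_
  rw [Real.exp_le_exp]
  linarith [le_of_abs_le ht]

theorem exp_neg_mul_rpow_isBigO_exp (σ δ : ℝ) :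
    (fun t : ℝ => Real.exp (-((|σ| + 1) * t ^ max δ 1))) =O[atTop]
      fun t => Real.exp (-(σ * t ^ δ + t)) := by
  refine IsBigO.of_bound 1 ?_
  filter_upwards [eventually_ge_atTop 1] with t ht
  rw [one_mul, Real.norm_of_nonneg (Real.exp_nonneg _), Real.norm_of_nonneg (Real.exp_nonneg _),
    Real.exp_le_exp, neg_le_neg_iff, add_one_mul]
  gcongr
  · exact le_abs_self σ
  · exact le_max_left _ _
  · exact Real.self_le_rpow_of_one_le ht (le_max_right _ _)

theorem locallyIntegrableOn_Ici_of_forall_integrableOn_Ioc {E : Type*} [NormedAddCommGroup E]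
    {g : ℝ → E} (hint : ∀ T : ℝ, 0 < T → IntegrableOn g (Ioc 0 T) volume) :
    LocallyIntegrableOn g (Ici 0) volume := by
  refine (locallyIntegrableOn_iff isClosed_Ici.isLocallyClosed).2 fun k hk hkc => ?_
  obtain ⟨T, hT⟩ := hkc.bddAbove
  refine ((integrableOn_Icc_iff_integrableOn_Ioc).2 (hint (max T 1) (by positivity))).mono_set ?_
  exact fun x hx => ⟨hk hx, (hT hx).trans (le_max_left _ _)⟩

section

variable {E : Type*} [NormedAddCommGroup E] [NormedSpace ℝ E] {g : ℝ → E}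
  (hint : ∀ T : ℝ, 0 < T → IntegrableOn g (Ioc 0 T) volume)
include hint

theorem integrableOn_Ioi_smul_of_isBigO {φ : ℝ → ℝ} (hφ : Continuous φ)
    (hdecay : (fun t => φ t • g t) =O[atTop] fun t => Real.exp (-t)) :
    IntegrableOn (fun t => φ t • g t) (Ioi 0) volume := by
  have hloc := (locallyIntegrableOn_Ici_of_forall_integrableOn_Ioc hint).continuousOn_smul
    isClosed_Ici.isLocallyClosed hφ.continuousOn
  exact (hloc.integrableOn_of_isBigO_atTop hdecay
    ⟨Ioi 0, Ioi_mem_atTop 0, integrableOn_exp_neg_Ioi 0⟩).mono_set Ioi_subset_Ici_self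

theorem tendsto_setIntegral_Ioc_wrightPhi_neg_smul [CompleteSpace E] (hcont : ContinuousAt g 1)
    {T : ℝ} (hT : 1 < T) :
    Tendsto (fun β : ℝ => ∫ t in Ioc 0 T, wrightPhi (-β) (1 - β) (-t) • g t) (𝓝[<] 1)
      (𝓝 (g 1)) := by
  refine tendsto_setIntegral_peak_smul_of_integrableOn_of_tendsto measurableSet_Ioc
    measurableSet_Ioc Subset.rfl self_mem_nhdsWithin measure_Ioc_lt_top.ne ?_
    (fun u hu h1u => (tendstoUniformlyOn_wrightPhi_neg (hu.mem_nhds h1u)).mono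
      (sdiff_subset_sdiff_left fun t ht => ht.1.le))
    (tendsto_setIntegral_Ioc_wrightPhi_neg hT) ?_ (hint T (by positivity))
    (hcont.mono_left nhdsWithin_le_nhds)
  · filter_upwards [Ioo_mem_nhdsLT one_pos] with β ⟨hβ0, hβ1⟩ t ht
    exact wrightPhi_neg_nonneg hβ0.le hβ1 (sub_nonneg.2 hβ1.le) ht.1.le
  · filter_upwards [Ioo_mem_nhdsLT one_pos] with β ⟨hβ0, hβ1⟩
    exact (continuous_wrightPhi_neg hβ0.le hβ1 _).aestronglyMeasurable

variable {σ δ : ℝ} (hgrowth : g =O[atTop] fun t : ℝ => Real.exp (σ * t ^ δ))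
include hgrowth

theorem integrableOn_Ioi_smul_of_isBigO_exp {φ : ℝ → ℝ} (hφ : Continuous φ)
    (hdecay : φ =O[atTop] fun t => Real.exp (-(σ * t ^ δ + t))) :
    IntegrableOn (fun t => φ t • g t) (Ioi 0) volume := by
  refine integrableOn_Ioi_smul_of_isBigO hint hφ ((hdecay.smul hgrowth).congr_right fun t => ?_)
  rw [smul_eq_mul, ← Real.exp_add, neg_add_rev, neg_add_cancel_right]

theorem tendsto_setIntegral_Ioi_wrightPhi_neg_smul {a : ℝ} (ha : 1 < a) :
    Tendsto (fun β : ℝ => ∫ t in Ioi a, wrightPhi (-β) (1 - β) (-t) • g t) (𝓝[<] 1) (𝓝 0) := by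
  have ha0 : 0 < a := zero_lt_one.trans ha
  have hK0 : 0 ≤ max δ 1 := zero_le_one.trans (le_max_right _ _)
  set w : ℝ → ℝ := fun t => Real.exp (-((|σ| + 1) * t ^ max δ 1))
  have hwcont : Continuous w :=
    (continuous_const.mul (continuous_id.rpow_const fun _ => Or.inr hK0)).neg.rexp
  have hwg : IntegrableOn (fun t => w t • g t) (Ioi a) volume :=
    (integrableOn_Ioi_smul_of_isBigO_exp hint hgrowth hwcont
      (exp_neg_mul_rpow_isBigO_exp σ δ)).mono_set (Ioi_subset_Ioi ha0.le)
  have hgmeas : AEStronglyMeasurable g (volume.restrict (Ioi a)) :=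
    (locallyIntegrableOn_Ici_of_forall_integrableOn_Ioc hint).aestronglyMeasurable.mono_set
      (Ioi_subset_Ici ha0.le)
  rw [← integral_zero ℝ E (μ := volume.restrict (Ioi a))]
  refine tendsto_integral_filter_of_dominated_convergence (fun t => ‖w t • g t‖) ?_ ?_ hwg.norm ?_
  · filter_upwards [Ioo_mem_nhdsLT one_pos] with β ⟨hβ0, hβ1⟩
    exact (continuous_wrightPhi_neg hβ0.le hβ1 _).aestronglyMeasurable.smul hgmeas
  · filter_upwards [eventually_wrightPhi_neg_le_exp ha (|σ| + 1) (max δ 1),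
      Ioo_mem_nhdsLT one_pos] with β hβ ⟨hβ0, hβ1⟩
    refine ae_restrict_of_forall_mem measurableSet_Ioi fun t (ht : a < t) => ?_
    rw [norm_smul, norm_smul, Real.norm_of_nonneg (Real.exp_nonneg _), Real.norm_of_nonneg
      (wrightPhi_neg_nonneg hβ0.le hβ1 (sub_nonneg.2 hβ1.le) (ha0.trans ht).le)]
    gcongr
    exact hβ _ le_rfl t ht.le
  · refine ae_restrict_of_forall_mem measurableSet_Ioi fun t (ht : a < t) => ?_
    simpa only [zero_smul] using (tendsto_wrightPhi_neg_of_one_lt (ha.trans ht)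
      (Eventually.of_forall fun β => le_rfl)).smul_const (g t)

end

theorem lemma4p2_general {E : Type*} [NormedAddCommGroup E] [NormedSpace ℝ E] [CompleteSpace E]
    (g : ℝ → E) (hint : ∀ T : ℝ, 0 < T → IntegrableOn g (Ioc 0 T) volume)
    (hcont : ContinuousAt g 1) (σ δ : ℝ)
    (hgrowth : g =O[atTop] fun t : ℝ => Real.exp (σ * t ^ δ)) :
    (∀ β : ℝ, 0 < β → β < 1 → δ < 1 / (1 - β) →
      IntegrableOn (fun t : ℝ => wrightPhi (-β) (1 - β) (-t) • g t) (Ioi 0) volume) ∧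
    Tendsto (fun β : ℝ => ∫ t in Ioi (0 : ℝ), wrightPhi (-β) (1 - β) (-t) • g t)
      (𝓝[<] 1) (𝓝 (g 1)) := by
  have hintegrable (β : ℝ) (hβ0 : 0 < β) (hβ1 : β < 1) (hδ : δ < 1 / (1 - β)) :
      IntegrableOn (fun t : ℝ => wrightPhi (-β) (1 - β) (-t) • g t) (Ioi 0) volume :=
    integrableOn_Ioi_smul_of_isBigO_exp hint hgrowth (continuous_wrightPhi_neg hβ0.le hβ1 _)
      (wrightPhi_neg_isBigO_exp hβ0 hβ1 hδ σ le_rfl)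
  refine ⟨hintegrable, ?_⟩
  have hlim := (tendsto_setIntegral_Ioc_wrightPhi_neg_smul hint hcont one_lt_two).add
    (tendsto_setIntegral_Ioi_wrightPhi_neg_smul hint hgrowth one_lt_two)
  rw [add_zero] at hlim
  refine hlim.congr' ?_
  filter_upwards [Ioo_mem_nhdsLT one_pos,
    tendsto_one_div_one_sub_atTop.eventually (eventually_gt_atTop δ)] with β ⟨hβ0, hβ1⟩ hδ
  have hβ := hintegrable β hβ0 hβ1 hδ
  rw [← Ioc_union_Ioi_eq_Ioi zero_le_two, setIntegral_union (Ioc_disjoint_Ioi le_rfl)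
    measurableSet_Ioi (hβ.mono_set Ioc_subset_Ioi_self) (hβ.mono_set (Ioi_subset_Ioi zero_le_two))]

theorem lemma4p2 {𝕜 : Type*} [RCLike 𝕜] (g : ℝ → 𝕜)
    (hint : ∀ T : ℝ, 0 < T → IntegrableOn g (Ioc 0 T) volume)
    (hcont : ContinuousAt g 1)
    (σ δ : ℝ) (hσ : 0 < σ)
    (hgrowth : g =O[atTop] fun t : ℝ => Real.exp (σ * t ^ δ)) :
    (∀ β : ℝ, 0 < β → β < 1 → δ < 1 / (1 - β) →
      IntegrableOn (fun t : ℝ => g t * ((wrightPhi (-β) (1 - β) (-t) : ℝ) : 𝕜)) (Ioi 0) volume) ∧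
    Tendsto (fun β : ℝ => ∫ t in Ioi (0 : ℝ), g t * ((wrightPhi (-β) (1 - β) (-t) : ℝ) : 𝕜))
      (𝓝[<] 1) (𝓝 (g 1)) := by
  simpa only [RCLike.real_smul_eq_coe_mul, mul_comm] using
    lemma4p2_general g hint hcont σ δ hgrowth
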